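/- Conventions. For a real matrix $M$, let $\mathcal Q(M)$ be the set of real matrices of the same size with the same sign pattern as $M$ (entrywise positive, negative or zero exactly where $M$ is), and $\mathcal Q_0(M)$ its topological closure. A real square matrix is a $P_0$-matrix if all its principal minors are nonnegative, and it is positive semistable if all its complex eigenvalues have nonnegative real part. For $M\in\mathbb R^{n\times n}$, the second additive compound $M^{[2]}$ is the matrix, in the basis $\{e_i\wedge e_j\}_{i<j}$ of $\Lambda^2\mathbb R^n$, of the linear map $u\wedge v\mapsto Mu\wedge v+u\wedge Mv$ (if $n=1$ it is the empty matrix, and assertions about it are void). For $A\in\mathbb R^{n\times m}$ and $B\in\mathbb R^{m\times n}$, the DSR graph $G_{A,B}$ is the signed, labelled bipartite digraph with vertices $S_1,\dots,S_n,R_1,\dots,R_m$, with an arc $R_jS_i$ of the sign of $A_{ij}$ whenever $A_{ij}\neq0$, and an arc $S_iR_j$ of the sign of $B_{ji}$ whenever $B_{ji}\ne0$; two antiparallel arcs of the same sign are merged into a single undirected edge. The label $l(e)$ of an edge that comes from a nonzero entry $A_{ij}$ (directed from $R_j$ to $S_i$, or undirected) is $|A_{ij}|$; an edge that is directed only from $S_i$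 to $R_j$ has label $\infty$. A cycle is a nonempty closed walk that repeats no vertex (except that its first and last vertices coincide) and no edge. A cycle with consecutive edges $(e_1,\dots,e_{2r})$ is an s-cycle if all its labels are finite and $\prod_{i=1}^r l(e_{2i-1})=\prod_{i=1}^r l(e_{2i})$. The graph is steady if all its cycles are s-cycles. Theorem. Let $A\in\mathbb R^{n\times m}$ be such that $G_{A,A^t}$ is steady. (i) If every column of $A$ has at most two nonzero entries, then for every $B\in\mathcal Q_0(A^t)$ both $AB$ and $(AB)^{[2]}$ are $P_0$-matrices, and $AB$ is positive semistable. (ii) If every row of $A$ has at most two nonzero entries, then $AB$ is positive semistable for every $B\in\mathcal Q_0(A^t)$. -/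

import Mathlib

open Matrix

noncomputable section

/-! ### Matrices -/

/-- The qualitative class `𝒬(M)`: all real matrices with the same sign pattern as `M`. -/
def qualClass {n m : ℕ} (M : Matrix (Fin n) (Fin m) ℝ) : Set (Matrix (Fin n) (Fin m) ℝ) :=
  {X | ∀ i j, (0 < M i j → 0 < X i j) ∧ (M i j < 0 → X i j < 0) ∧ (M i j = 0 → X i j = 0)}

/-- `𝒬₀(M)`: the topological closure of the qualitative class of `M`. -/
def qualClassClosure {n m : ℕ} (M : Matrix (Fin n) (Fin m) ℝ) :
    Set (Matrix (Fin n) (Fin m) ℝ) :=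
  closure (qualClass M)

/-- A `P₀`-matrix: a real square matrix all of whose principal minors are nonnegative. -/
def IsP0Matrix {ι : Type*} [DecidableEq ι] (M : Matrix ι ι ℝ) : Prop :=
  ∀ α : Finset ι, 0 ≤ (M.submatrix (fun i : α => (i : ι)) (fun i : α => (i : ι))).det

/-- A real square matrix is positive semistable if all its (complex) eigenvalues lie in the closed
right half-plane. -/
def IsPositiveSemistable {n : ℕ} (M : Matrix (Fin n) (Fin n) ℝ) : Prop :=
  ∀ z ∈ spectrum ℂ (M.map (fun x : ℝ => (x : ℂ))), 0 ≤ z.re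

/-! ### Additive compounds -/

/-- The alternating map
`(u₁, …, u_k) ↦ ∑ i, u₁ ∧ ⋯ ∧ f u_i ∧ ⋯ ∧ u_k`. -/
def additiveCompoundAlternating {V : Type*} [AddCommGroup V] [Module ℝ V] (k : ℕ)
    (f : V →ₗ[ℝ] V) : V [⋀^Fin k]→ₗ[ℝ] (⋀[ℝ]^k V) where
  toMultilinearMap := ∑ i : Fin k, (exteriorPower.ιMulti ℝ k).toMultilinearMap.compLinearMap
    (Function.update (fun _ => LinearMap.id) i f)
  map_eq_zero_of_eq' := by
    intro u a b hab hne
    have key : ∀ i, (fun j => (Function.update (fun _ => LinearMap.id) i f :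
        Fin k → V →ₗ[ℝ] V) j (u j)) = Function.update u i (f (u i)) := by
      intro i
      funext j
      by_cases h : j = i
      · subst h; simp
      · simp [h]
    simp only [MultilinearMap.toFun_eq_coe, _root_.sum_apply,
      MultilinearMap.compLinearMap_apply, key, AlternatingMap.coe_multilinearMap]
    rw [← Finset.sum_subset (Finset.subset_univ {a, b})]
    · rw [Finset.sum_pair hne]
      have hsw : Function.update u b (f (u b)) =
          Function.update u a (f (u a)) ∘ Equiv.swap a b := by
        funext j
        by_cases hja : j = a
        · subst hja; simp [hne, hne.symm, hab]
        · by_cases hjb : j = b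
          · subst hjb; simp [hab]
          · simp [hja, hjb, Equiv.swap_apply_of_ne_of_ne]
      rw [hsw, AlternatingMap.map_swap _ _ hne]
      simp
    · intro i _ hi
      simp only [Finset.mem_insert, Finset.mem_singleton, not_or] at hi
      refine AlternatingMap.map_eq_zero_of_eq _ _ (i := a) (j := b) ?_ hne
      simp [Ne.symm hi.1, Ne.symm hi.2, hab]

/-- The `k`th additive compound of a linear map `f : V → V`, as a linear map on `Λᵏ V`. -/
def additiveCompoundMap {V : Type*} [AddCommGroup V] [Module ℝ V] (k : ℕ) (f : V →ₗ[ℝ] V) :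
    ⋀[ℝ]^k V →ₗ[ℝ] ⋀[ℝ]^k V :=
  exteriorPower.alternatingMapLinearEquiv (additiveCompoundAlternating k f)

/-- The defining property
`f^{[k]}(u₁ ∧ ⋯ ∧ u_k) = ∑ i, u₁ ∧ ⋯ ∧ f u_i ∧ ⋯ ∧ u_k`. -/
theorem additiveCompoundMap_apply_ιMulti {V : Type*} [AddCommGroup V] [Module ℝ V] (k : ℕ)
    (f : V →ₗ[ℝ] V) (u : Fin k → V) :
    additiveCompoundMap k f (exteriorPower.ιMulti ℝ k u) =
      ∑ i, exteriorPower.ιMulti ℝ k (Function.update u i (f (u i))) := by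
  rw [additiveCompoundMap, exteriorPower.alternatingMapLinearEquiv_apply_ιMulti]
  change (∑ i : Fin k, (exteriorPower.ιMulti ℝ k).toMultilinearMap.compLinearMap
    (Function.update (fun _ => LinearMap.id) i f)) u = _
  rw [_root_.sum_apply]
  refine Finset.sum_congr rfl fun i _ => ?_
  rw [MultilinearMap.compLinearMap_apply]
  change exteriorPower.ιMulti ℝ k _ = _
  congr 1
  funext j
  by_cases h : j = i
  · subst h; simp
  · simp [h]

/-- The `k`th additive compound `M^{[k]}` of a square matrix, written in the basis
`e_{i₁} ∧ ⋯ ∧ e_{i_k}`, `i₁ < ⋯ < i_k`, of `Λᵏ ℝⁿ`. -/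
def additiveCompound {n : ℕ} (k : ℕ) (M : Matrix (Fin n) (Fin n) ℝ) :
    Matrix (Set.powersetCard (Fin n) k) (Set.powersetCard (Fin n) k) ℝ :=
  LinearMap.toMatrix ((Pi.basisFun ℝ (Fin n)).exteriorPower k)
    ((Pi.basisFun ℝ (Fin n)).exteriorPower k) (additiveCompoundMap k (Matrix.toLin' M))

/-! ### DSR graphs -/

/-- Vertices of a DSR graph: the S-vertices `S_i` are `Sum.inl i`, the R-vertices `R_j` are
`Sum.inr j`. -/
abbrev DSRVertex (n m : ℕ) : Type := Fin n ⊕ Fin m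

/-- Orientation of an edge of a DSR graph: only R-to-S, only S-to-R, or both (undirected). -/
inductive DSROrientation : Type
  | rToS
  | sToR
  | undirected

/-- The edges of the DSR graph `G_{A,B}` between `S_i` and `R_j`. There is an arc `R_j S_i` with
the sign of `A i j` if `A i j ≠ 0`, and an arc `S_i R_j` with the sign of `B j i` if `B j i ≠ 0`;
two antiparallel arcs of the same sign are merged into one undirected edge. -/
def DSREdgeExists {n m : ℕ} (A : Matrix (Fin n) (Fin m) ℝ) (B : Matrix (Fin m) (Fin n) ℝ)
    (i : Fin n) (j : Fin m) : DSROrientation → Prop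
  | .rToS => A i j ≠ 0 ∧ SignType.sign (A i j) ≠ SignType.sign (B j i)
  | .sToR => B j i ≠ 0 ∧ SignType.sign (A i j) ≠ SignType.sign (B j i)
  | .undirected => A i j ≠ 0 ∧ SignType.sign (A i j) = SignType.sign (B j i)

/-- An edge of the DSR graph `G_{A,B}`. -/
@[ext]
structure DSREdge {n m : ℕ} (A : Matrix (Fin n) (Fin m) ℝ) (B : Matrix (Fin m) (Fin n) ℝ) where
  /-- the index of the S-vertex -/
  s : Fin n
  /-- the index of the R-vertex -/
  r : Fin m
  /-- the orientation -/
  orient : DSROrientation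
  /-- the edge is present in the graph -/
  valid : DSREdgeExists A B s r orient

namespace DSREdge

variable {n m : ℕ} {A : Matrix (Fin n) (Fin m) ℝ} {B : Matrix (Fin m) (Fin n) ℝ}

/-- The sign of an edge. -/
def sign (e : DSREdge A B) : SignType :=
  match e.orient with
  | .rToS => SignType.sign (A e.s e.r)
  | .sToR => SignType.sign (B e.r e.s)
  | .undirected => SignType.sign (A e.s e.r)

/-- The label of an edge: `|A i j|` if the edge has R-to-S orientation or is undirected, and `∞`
if it has only S-to-R orientation. -/
def label (e : DSREdge A B) : ENNReal :=
  match e.orient with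
  | .rToS => ENNReal.ofReal |A e.s e.r|
  | .sToR => ⊤
  | .undirected => ENNReal.ofReal |A e.s e.r|

/-- `e.Goes u v`: the edge `e` can be traversed from `u` to `v`. -/
def Goes (e : DSREdge A B) (u v : DSRVertex n m) : Prop :=
  (e.orient ≠ .sToR ∧ u = Sum.inr e.r ∧ v = Sum.inl e.s) ∨
    (e.orient ≠ .rToS ∧ u = Sum.inl e.s ∧ v = Sum.inr e.r)

end DSREdge

/-- A closed walk in the DSR graph `G_{A,B}`: vertices `v₀, v₁, …, v_len = v₀` and edges
`e₀, …, e_{len-1}`, where `e_k` goes from `v_k` to `v_{k+1}`. -/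
structure DSRClosedWalk {n m : ℕ} (A : Matrix (Fin n) (Fin m) ℝ)
    (B : Matrix (Fin m) (Fin n) ℝ) where
  /-- the length, i.e. the number of edges -/
  len : ℕ
  /-- the sequence of vertices -/
  vert : Fin (len + 1) → DSRVertex n m
  /-- the sequence of edges -/
  edge : Fin len → DSREdge A B
  /-- each edge is preceded by its start-point and followed by its end-point -/
  goes : ∀ k : Fin len, (edge k).Goes (vert k.castSucc) (vert k.succ)
  /-- the walk is closed -/
  closed : vert 0 = vert (Fin.last len)

namespace DSRClosedWalk

variable {n m : ℕ} {A : Matrix (Fin n) (Fin m) ℝ} {B : Matrix (Fin m) (Fin n) ℝ}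

/-- A cycle: a nonempty closed walk that repeats no vertex (except that the first and the last
vertex agree) and no edge. The latter excludes running back and forth along one undirected edge;
two distinct antiparallel edges do form a cycle of length two. -/
def IsCycle (W : DSRClosedWalk A B) : Prop :=
  0 < W.len ∧ Function.Injective (fun k : Fin W.len => W.vert k.castSucc) ∧
    Function.Injective W.edge

/-- An s-walk: a closed walk all of whose labels are finite, and such that the product of the
labels of its first, third, fifth, … edges equals that of its second, fourth, sixth, … edges.
(Closed walks have even length since the graph is bipartite.) -/
def IsSWalk (W : DSRClosedWalk A B) : Prop :=
  (∀ k, (W.edge k).label ≠ ⊤) ∧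
    ∏ k ∈ Finset.univ.filter (fun k : Fin W.len => Even (k : ℕ)), (W.edge k).label =
      ∏ k ∈ Finset.univ.filter (fun k : Fin W.len => Odd (k : ℕ)), (W.edge k).label

end DSRClosedWalk

/-- The DSR graph `G_{A,B}` is steady: all its cycles are s-cycles. -/
def DSRSteady {n m : ℕ} (A : Matrix (Fin n) (Fin m) ℝ) (B : Matrix (Fin m) (Fin n) ℝ) : Prop :=
  ∀ W : DSRClosedWalk A B, W.IsCycle → W.IsSWalk

end

/-! Give the edge `S_i R_j` of the support graph the weight `log |A i j|`, with opposite sign when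
traversed backwards. Steadiness makes every cycle sum vanish, so the weight is a potential
difference (`exists_potential`). Exponentiating, `|A i j| = x i * y j` wherever `A i j ≠ 0`.

After row `i` is divided by `x i`, all nonzero entries of column `j` have absolute value `y j`. If a
column has at most two of them, each dominates the rest of its column. Since `A i j * B j i ≥ 0`,
nothing cancels on the diagonal of `A * B`, which is therefore column diagonally dominant with
weights `1 / x i` (`colDominant_mul`). Such dominance passes to principal submatrices and to
additive compounds (`ColDominant.additiveCompound`), gives nonnegative determinants by deformation
to the identity, and puts the spectrum in the right half-plane by Gershgorin's argument.

Part (ii) is reduced to sparse columns by transposition, as `A * B` and `Aᵀ * Bᵀ = (B * A)ᵀ` have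
the same nonzero eigenvalues. -/

noncomputable section

/-! ### Potentials on graphs -/

namespace SimpleGraph

variable {V : Type*} {G : SimpleGraph V}

/-- The total weight of a walk, for weights given on ordered pairs of vertices. -/
def Walk.weight (w : V → V → ℝ) {u v : V} (p : G.Walk u v) : ℝ :=
  (p.darts.map fun d => w d.fst d.snd).sum

theorem Walk.weight_nil (w : V → V → ℝ) (u : V) : (Walk.nil : G.Walk u u).weight w = 0 := by
  simp [Walk.weight]

theorem Walk.weight_cons (w : V → V → ℝ) {u v t : V} (h : G.Adj u v) (p : G.Walk v t) :
    (Walk.cons h p).weight w = w u v + p.weight w := by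
  simp [Walk.weight]

theorem Walk.weight_append (w : V → V → ℝ) {u v t : V} (p : G.Walk u v) (q : G.Walk v t) :
    (p.append q).weight w = p.weight w + q.weight w := by
  simp [Walk.weight]

theorem Walk.weight_reverse {w : V → V → ℝ} (hw : ∀ u v, w u v = -w v u) {u v : V}
    (p : G.Walk u v) : p.reverse.weight w = -p.weight w := by
  induction p with
  | nil => simp [Walk.weight]
  | cons h p ih =>
    rw [Walk.reverse_cons, Walk.weight_append, ih, Walk.weight_cons, Walk.weight_cons,
      Walk.weight_nil, hw]
    ring

theorem Walk.weight_eq_sum_range (w : V → V → ℝ) {u v : V} (p : G.Walk u v) :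
    p.weight w = ∑ k ∈ Finset.range p.length, w (p.getVert k) (p.getVert (k + 1)) := by
  induction p with
  | nil => simp [Walk.weight]
  | cons h p ih =>
    rw [Walk.weight_cons, ih, Walk.length_cons, Finset.sum_range_succ']
    simp only [Walk.getVert_cons_succ, Walk.getVert_zero, add_comm (w _ _)]

/-- If all cycles have weight zero then erasing loops does not change the weight of a walk. -/
theorem Walk.weight_bypass [DecidableEq V] {w : V → V → ℝ} (hw : ∀ u v, w u v = -w v u)
    (hcyc : ∀ (u : V) (p : G.Walk u u), p.IsCycle → p.weight w = 0) {u v : V}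
    (p : G.Walk u v) : p.bypass.weight w = p.weight w := by
  induction p with
  | nil => rfl
  | @cons a b c h p ih =>
    rw [Walk.weight_cons, ← ih]
    simp only [Walk.bypass]
    split_ifs with hs
    · have hsplit : p.bypass.weight w =
          (p.bypass.takeUntil a hs).weight w + (p.bypass.dropUntil a hs).weight w := by
        rw [← Walk.weight_append, Walk.take_spec]
      have hpath : (p.bypass.takeUntil a hs).IsPath := p.bypass_isPath.takeUntil hs
      suffices w a b + (p.bypass.takeUntil a hs).weight w = 0 by rw [hsplit]; linarith
      -- The erased loop is the edge `a b` followed by a path from `b` to `a`. If that path contains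
      -- the same edge, it is just the edge reversed and the weights cancel; otherwise the loop is a
      -- genuine cycle.
      by_cases he : s(a, b) ∈ (p.bypass.takeUntil a hs).edges
      · rw [hpath.eq_adj_toWalk_of_mem_edges (by rwa [Sym2.eq_swap])]
        simp only [Adj.toWalk, Walk.weight_cons, Walk.weight_nil]
        rw [hw a b]
        ring
      · rw [← Walk.weight_cons w h]
        exact hcyc _ _ ((Walk.cons_isCycle_iff _ _).mpr ⟨hpath, he⟩)
    · rw [Walk.weight_cons]

/-- An antisymmetric weight with vanishing sum along every cycle has a potential. -/
theorem exists_potential {w : V → V → ℝ} (hw : ∀ u v, w u v = -w v u)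
    (hcyc : ∀ (u : V) (p : G.Walk u u), p.IsCycle → p.weight w = 0) :
    ∃ g : V → ℝ, ∀ u v, G.Adj u v → w u v = g v - g u := by
  classical
  have hclosed : ∀ (u : V) (p : G.Walk u u), p.weight w = 0 := by
    intro u p
    rw [← Walk.weight_bypass hw hcyc, (Walk.isPath_iff_nil.mp p.bypass_isPath).eq_nil, Walk.weight_nil]
  have hreach : ∀ v, G.Reachable (G.connectedComponentMk v).out v := fun v =>
    ConnectedComponent.exact (Quot.out_eq _)
  refine ⟨fun v => (hreach v).some.weight w, fun u v h => ?_⟩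
  have hroot : (G.connectedComponentMk u).out = (G.connectedComponentMk v).out := by
    rw [ConnectedComponent.sound h.reachable]
  -- The chosen roots of the components of `u` and `v` are equal only propositionally, so the base
  -- points are generalized.
  have key : ∀ (r s : V) (p : G.Walk r u) (q : G.Walk s v), r = s →
      w u v = q.weight w - p.weight w := by
    rintro r _ p q rfl
    have := hclosed _ (p.append (Walk.cons h q.reverse))
    rw [Walk.weight_append, Walk.weight_cons, Walk.weight_reverse hw] at this
    linarith
  exact key _ _ _ _ hroot

end SimpleGraph

/-! ### Steady DSR graphs -/

/-- The bipartite graph of the nonzero entries of a matrix. -/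
def supportGraph {n m : ℕ} (A : Matrix (Fin n) (Fin m) ℝ) : SimpleGraph (DSRVertex n m) where
  Adj u v := (∃ i j, A i j ≠ 0 ∧ u = Sum.inl i ∧ v = Sum.inr j) ∨
    ∃ i j, A i j ≠ 0 ∧ u = Sum.inr j ∧ v = Sum.inl i
  symm := ⟨by
    rintro u v (⟨i, j, h, rfl, rfl⟩ | ⟨i, j, h, rfl, rfl⟩)
    · exact Or.inr ⟨i, j, h, rfl, rfl⟩
    · exact Or.inl ⟨i, j, h, rfl, rfl⟩⟩
  loopless := ⟨by rintro u (⟨i, j, h, rfl, h'⟩ | ⟨i, j, h, rfl, h'⟩) <;> simp at h'⟩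

/-- The logarithmic weight `log |A i j|` on `S_i R_j`, with the opposite sign on `R_j S_i`. -/
def logWeight {n m : ℕ} (A : Matrix (Fin n) (Fin m) ℝ) : DSRVertex n m → DSRVertex n m → ℝ
  | Sum.inl i, Sum.inr j => Real.log |A i j|
  | Sum.inr j, Sum.inl i => -Real.log |A i j|
  | _, _ => 0

theorem logWeight_antisymm {n m : ℕ} (A : Matrix (Fin n) (Fin m) ℝ) (u v : DSRVertex n m) :
    logWeight A u v = -logWeight A v u := by
  cases u <;> cases v <;> simp [logWeight]

/-- For `B = Aᵀ` antiparallel arcs have equal signs, so an undirected edge is always available. The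
final disjunction records the direction of travel, on which the sign of `logWeight` depends. -/
theorem exists_edge_of_adj {n m : ℕ} {A : Matrix (Fin n) (Fin m) ℝ} {u v : DSRVertex n m}
    (h : (supportGraph A).Adj u v) : ∃ e : DSREdge A Aᵀ, e.Goes u v ∧
      0 < |A e.s e.r| ∧ e.label = ENNReal.ofReal |A e.s e.r| ∧
      ((u = Sum.inl e.s ∧ v = Sum.inr e.r) ∨ (u = Sum.inr e.r ∧ v = Sum.inl e.s)) := by
  rcases h with ⟨i, j, h, rfl, rfl⟩ | ⟨i, j, h, rfl, rfl⟩
  · exact ⟨⟨i, j, .undirected, h, rfl⟩, Or.inr ⟨by simp, rfl, rfl⟩, abs_pos.mpr h, rfl,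
      Or.inl ⟨rfl, rfl⟩⟩
  · exact ⟨⟨i, j, .undirected, h, rfl⟩, Or.inl ⟨by simp, rfl, rfl⟩, abs_pos.mpr h, rfl,
      Or.inr ⟨rfl, rfl⟩⟩

/-- Along a walk in the support graph the two vertex classes alternate. -/
theorem isLeft_getVert {n m : ℕ} {A : Matrix (Fin n) (Fin m) ℝ} {u v : DSRVertex n m}
    (p : (supportGraph A).Walk u v) {k : ℕ} (hk : k ≤ p.length) :
    ((p.getVert k).isLeft = true ↔ (u.isLeft = true ↔ Even k)) := by
  induction k with
  | zero => simp
  | succ k ih =>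
    have h := p.adj_getVert_succ (i := k) (by omega)
    have ih := ih (by omega)
    rw [Nat.even_add_one]
    rcases h with ⟨i, j, -, h1, h2⟩ | ⟨i, j, -, h1, h2⟩ <;> rw [h1] at ih <;> rw [h2] <;>
      simp [-Nat.not_even_iff_odd] at ih ⊢ <;> tauto

/-- Steps along the cycle go alternately from S to R and from R to S, so the weight is, up to a
global sign, the logarithm of the even-position label product minus that of the odd-position one.
The s-cycle condition makes these equal. -/
theorem weight_eq_zero_of_isCycle {n m : ℕ} {A : Matrix (Fin n) (Fin m) ℝ}
    (hA : DSRSteady A Aᵀ) (u : DSRVertex n m) (p : (supportGraph A).Walk u u) (hp : p.IsCycle) :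
    p.weight (logWeight A) = 0 := by
  choose e hgoes hpos hlabel hends using fun k : Fin p.length =>
    exists_edge_of_adj (p.adj_getVert_succ k.isLt)
  let W : DSRClosedWalk A Aᵀ :=
    { len := p.length
      vert := fun k => p.getVert k
      edge := e
      goes := hgoes
      closed := by simp }
  have hW : W.IsCycle := by
    refine ⟨by have := hp.three_le_length; change 0 < p.length; omega, ?_, ?_⟩
    · intro k l hkl
      have hk : (k : ℕ) < p.length := k.isLt
      have hl : (l : ℕ) < p.length := l.isLt
      exact Fin.ext (hp.getVert_injOn' (by simp only [Set.mem_ofPred_eq]; omega)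
        (by simp only [Set.mem_ofPred_eq]; omega) hkl)
    · intro k l hkl
      change e k = e l at hkl
      have hs : ∀ k : Fin p.length,
          s(p.getVert k, p.getVert (k + 1)) = s(Sum.inl (e k).s, Sum.inr (e k).r) := by
        intro k
        rcases hends k with ⟨h1, h2⟩ | ⟨h1, h2⟩
        · rw [h1, h2]
        · rw [h1, h2, Sym2.eq_swap]
      have hnd := hp.edges_nodup
      have hk : (k : ℕ) < p.edges.length := by rw [p.length_edges]; exact k.isLt
      have hl : (l : ℕ) < p.edges.length := by rw [p.length_edges]; exact l.isLt
      refine Fin.ext ((hnd.getElem_inj_iff (hi := hk) (hj := hl)).mp ?_)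
      rw [SimpleGraph.Walk.getElem_edges, SimpleGraph.Walk.getElem_edges, hs k, hs l, hkl]
  have hprod := (hA W hW).2
  change ∏ k ∈ Finset.univ.filter (fun k : Fin p.length => Even (k : ℕ)), (e k).label =
      ∏ k ∈ Finset.univ.filter (fun k : Fin p.length => Odd (k : ℕ)), (e k).label at hprod
  simp only [hlabel] at hprod
  rw [← ENNReal.ofReal_prod_of_nonneg (fun _ _ => abs_nonneg _),
    ← ENNReal.ofReal_prod_of_nonneg (fun _ _ => abs_nonneg _),
    ENNReal.ofReal_eq_ofReal_iff (Finset.prod_nonneg fun _ _ => abs_nonneg _)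
      (Finset.prod_nonneg fun _ _ => abs_nonneg _)] at hprod
  have hlog := congrArg Real.log hprod
  rw [Real.log_prod (fun k _ => (hpos k).ne'), Real.log_prod (fun k _ => (hpos k).ne')] at hlog
  rw [p.weight_eq_sum_range, ← Fin.sum_univ_eq_sum_range
    (fun k => logWeight A (p.getVert k) (p.getVert (k + 1)))]
  have hsplit := Finset.sum_filter_add_sum_filter_not (Finset.univ : Finset (Fin p.length))
    (fun k => Even (k : ℕ)) (fun k => logWeight A (p.getVert k) (p.getVert (k + 1)))
  simp only [Nat.not_even_iff_odd] at hsplit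
  rw [← hsplit]
  -- The condition of the `if` says that step `k` leaves an S-vertex.
  have hterm : ∀ k : Fin p.length, logWeight A (p.getVert k) (p.getVert (k + 1)) =
      if (u.isLeft = true ↔ Even (k : ℕ)) then Real.log |A (e k).s (e k).r|
        else -Real.log |A (e k).s (e k).r| := by
    intro k
    have hpar := isLeft_getVert p k.isLt.le
    rcases hends k with ⟨h1, h2⟩ | ⟨h1, h2⟩
    · rw [h1] at hpar
      rw [h1, h2, if_pos (hpar.mp rfl)]
      rfl
    · rw [h1] at hpar
      rw [h1, h2, if_neg (fun h => by simpa using hpar.mpr h)]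
      rfl
  have heven : ∑ k ∈ Finset.univ.filter (fun k : Fin p.length => Even (k : ℕ)),
      logWeight A (p.getVert k) (p.getVert (k + 1)) =
      (if u.isLeft = true then 1 else -1) *
        ∑ k ∈ Finset.univ.filter (fun k : Fin p.length => Even (k : ℕ)), Real.log |A (e k).s (e k).r| := by
    rw [Finset.mul_sum]
    refine Finset.sum_congr rfl fun k hk => ?_
    have hk := (Finset.mem_filter.mp hk).2
    rw [hterm]
    by_cases hu : u.isLeft = true <;> simp [hu, hk]
  have hodd : ∑ k ∈ Finset.univ.filter (fun k : Fin p.length => Odd (k : ℕ)),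
      logWeight A (p.getVert k) (p.getVert (k + 1)) =
      -((if u.isLeft = true then 1 else -1) *
        ∑ k ∈ Finset.univ.filter (fun k : Fin p.length => Odd (k : ℕ)), Real.log |A (e k).s (e k).r|) := by
    rw [Finset.mul_sum, ← Finset.sum_neg_distrib]
    refine Finset.sum_congr rfl fun k hk => ?_
    have hk : ¬Even (k : ℕ) := Nat.not_even_iff_odd.mpr (Finset.mem_filter.mp hk).2
    rw [hterm]
    by_cases hu : u.isLeft = true <;> simp [hu, hk]
  rw [heven, hodd, hlog]
  ring

/-- The entries of a matrix with steady graph are, up to sign, those of a rank one matrix. -/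
theorem DSRSteady.exists_rank_one {n m : ℕ} {A : Matrix (Fin n) (Fin m) ℝ}
    (hA : DSRSteady A Aᵀ) : ∃ (x : Fin n → ℝ) (y : Fin m → ℝ), (∀ i, 0 < x i) ∧ (∀ j, 0 < y j) ∧
      ∀ i j, A i j ≠ 0 → |A i j| = x i * y j := by
  obtain ⟨g, hg⟩ := SimpleGraph.exists_potential (logWeight_antisymm A)
    (weight_eq_zero_of_isCycle hA)
  refine ⟨fun i => Real.exp (-g (Sum.inl i)), fun j => Real.exp (g (Sum.inr j)),
    fun i => Real.exp_pos _, fun j => Real.exp_pos _, fun i j h => ?_⟩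
  have := hg (Sum.inl i) (Sum.inr j) (Or.inl ⟨i, j, h, rfl, rfl⟩)
  rw [← Real.exp_add, ← Real.exp_log (abs_pos.mpr h)]
  congr 1
  change Real.log |A i j| = _ at this
  linarith

/-! ### Weighted column diagonal dominance -/

section Dominance

variable {ι : Type*} [Fintype ι] [DecidableEq ι]

/-- Column diagonal dominance, with nonnegative diagonal, after scaling the rows by `u`. -/
def ColDominant (u : ι → ℝ) (M : Matrix ι ι ℝ) : Prop :=
  ∀ i, ∑ k ∈ Finset.univ.erase i, |M k i| * u k ≤ M i i * u i

theorem ColDominant.diag_nonneg {u : ι → ℝ} (hu : ∀ i, 0 < u i) {M : Matrix ι ι ℝ}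
    (h : ColDominant u M) (i : ι) : 0 ≤ M i i :=
  nonneg_of_mul_nonneg_left ((Finset.sum_nonneg fun k _ =>
    mul_nonneg (abs_nonneg _) (hu k).le).trans (h i)) (hu i)

/-- Multiplication by `diagonal u` on the left reduces this to ordinary strict dominance. Real
scalars serve for determinants, complex ones for eigenvalues. -/
theorem det_ne_zero_of_weighted_col {K : Type*} [RCLike K] {u : ι → ℝ} (hu : ∀ i, 0 < u i)
    {N : Matrix ι ι K} (h : ∀ i, ∑ k ∈ Finset.univ.erase i, ‖N k i‖ * u k < ‖N i i‖ * u i) :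
    N.det ≠ 0 := by
  have hdet : (Matrix.diagonal (fun i => (u i : K)) * N).det ≠ 0 := by
    refine det_ne_zero_of_sum_col_lt_diag fun i => ?_
    have hn : ∀ k, ‖(Matrix.diagonal (fun i => (u i : K)) * N) k i‖ = ‖N k i‖ * u k := by
      intro k
      rw [Matrix.diagonal_mul, norm_mul, RCLike.norm_ofReal, abs_of_pos (hu k), mul_comm]
    simpa only [hn] using h i
  rw [Matrix.det_mul] at hdet
  exact right_ne_zero_of_mul hdet

/-- On the segment from `1` to `M` dominance is strict before the endpoint, so the determinant
starts at 1 and cannot vanish there; nonnegativity at `M` follows by continuity. -/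
theorem ColDominant.det_nonneg {u : ι → ℝ} (hu : ∀ i, 0 < u i) {M : Matrix ι ι ℝ}
    (h : ColDominant u M) : 0 ≤ M.det := by
  let f : ℝ → ℝ := fun s => ((1 - s) • (1 : Matrix ι ι ℝ) + s • M).det
  have hf : Continuous f := by
    refine Continuous.matrix_det ?_
    fun_prop
  have hne : ∀ s ∈ Set.Ico (0 : ℝ) 1, f s ≠ 0 := by
    intro s hs
    refine det_ne_zero_of_weighted_col (K := ℝ) hu fun i => ?_
    have hoff : ∑ k ∈ Finset.univ.erase i,
        ‖((1 - s) • (1 : Matrix ι ι ℝ) + s • M) k i‖ * u k =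
        s * ∑ k ∈ Finset.univ.erase i, |M k i| * u k := by
      rw [Finset.mul_sum]
      refine Finset.sum_congr rfl fun k hk => ?_
      rw [Matrix.add_apply, Matrix.smul_apply, Matrix.smul_apply,
        Matrix.one_apply_ne (Finset.ne_of_mem_erase hk), smul_zero, zero_add, smul_eq_mul,
        Real.norm_eq_abs, abs_mul, abs_of_nonneg hs.1, mul_assoc]
    have hdiag : ‖((1 - s) • (1 : Matrix ι ι ℝ) + s • M) i i‖ = (1 - s) + s * M i i := by
      rw [Matrix.add_apply, Matrix.smul_apply, Matrix.smul_apply, Matrix.one_apply_eq, smul_eq_mul,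
        smul_eq_mul, mul_one, Real.norm_eq_abs, abs_of_nonneg]
      exact add_nonneg (by linarith [hs.2]) (mul_nonneg hs.1 (h.diag_nonneg hu i))
    rw [hoff, hdiag, add_mul, mul_assoc]
    have h1 := mul_le_mul_of_nonneg_left (h i) hs.1
    have h2 := mul_pos (sub_pos.mpr hs.2) (hu i)
    linarith
  have hpos : ∀ s ∈ Set.Ico (0 : ℝ) 1, 0 ≤ f s := by
    intro s hs
    by_contra! hlt
    have h0 : f 0 = 1 := by simp [f]
    obtain ⟨t, ht, ht0⟩ := intermediate_value_Icc' hs.1 hf.continuousOn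
      (show (0 : ℝ) ∈ Set.Icc (f s) (f 0) from ⟨hlt.le, by rw [h0]; exact zero_le_one⟩)
    exact hne t ⟨ht.1, ht.2.trans_lt hs.2⟩ ht0
  have hcl : (1 : ℝ) ∈ closure (Set.Ico (0 : ℝ) 1) := by
    rw [closure_Ico zero_ne_one]
    exact ⟨zero_le_one, le_rfl⟩
  have h1 : (1 : ℝ) ∈ {s | 0 ≤ f s} :=
    closure_minimal hpos (isClosed_le continuous_const hf) hcl
  simpa [f] using h1

theorem ColDominant.submatrix {u : ι → ℝ} (hu : ∀ i, 0 < u i) {M : Matrix ι ι ℝ}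
    (h : ColDominant u M) (α : Finset ι) :
    ColDominant (fun i : α => u i) (M.submatrix (fun i : α => (i : ι)) (fun i : α => (i : ι))) := by
  intro i
  refine le_trans ?_ (h i)
  simp only [Matrix.submatrix_apply]
  rw [← Finset.sum_image (s := Finset.univ.erase i) (g := fun i : α => (i : ι))
    (f := fun k => |M k i| * u k) (fun a _ b _ hab => Subtype.ext hab)]
  refine Finset.sum_le_sum_of_subset_of_nonneg ?_ fun k _ _ => mul_nonneg (abs_nonneg _) (hu k).le
  intro k hk
  obtain ⟨a, ha, rfl⟩ := Finset.mem_image.mp hk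
  exact Finset.mem_erase.mpr ⟨fun hai => Finset.ne_of_mem_erase ha (Subtype.ext hai),
    Finset.mem_univ _⟩

theorem ColDominant.isP0Matrix {u : ι → ℝ} (hu : ∀ i, 0 < u i) {M : Matrix ι ι ℝ}
    (h : ColDominant u M) : IsP0Matrix M :=
  fun α => ColDominant.det_nonneg (u := fun i : α => u i) (fun i => hu i) (h.submatrix hu α)

/-- If `z.re < 0` then `‖z - M i i‖ ≥ M i i - z.re > M i i`, so `z - M` is strictly dominant and
hence invertible. -/
theorem ColDominant.re_nonneg {n : ℕ} {u : Fin n → ℝ} (hu : ∀ i, 0 < u i)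
    {M : Matrix (Fin n) (Fin n) ℝ} (h : ColDominant u M) : IsPositiveSemistable M := by
  intro z hz
  by_contra! hre
  rw [spectrum.mem_iff, Matrix.isUnit_iff_isUnit_det, isUnit_iff_ne_zero, not_not] at hz
  refine det_ne_zero_of_weighted_col (K := ℂ) hu (fun i => ?_) hz
  have hoff : ∑ k ∈ Finset.univ.erase i,
      ‖(algebraMap ℂ (Matrix (Fin n) (Fin n) ℂ) z - M.map (fun x : ℝ => (x : ℂ))) k i‖ * u k =
      ∑ k ∈ Finset.univ.erase i, |M k i| * u k := by
    refine Finset.sum_congr rfl fun k hk => ?_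
    simp [Matrix.algebraMap_matrix_apply, Finset.ne_of_mem_erase hk]
  rw [hoff]
  refine (h i).trans_lt (mul_lt_mul_of_pos_right ?_ (hu i))
  simp only [Matrix.sub_apply, Matrix.algebraMap_matrix_apply, if_true, Matrix.map_apply,
    Algebra.algebraMap_self_apply]
  have h1 := (abs_le.mp (Complex.abs_re_le_norm (z - (M i i : ℂ)))).1
  rw [Complex.sub_re, Complex.ofReal_re] at h1
  linarith

end Dominance

/-! ### Dominance of additive compounds -/

section Compound

variable {n k : ℕ}

/-- The coordinate at `e_S` of `e_{f 0} ∧ ⋯ ∧ e_{f (k-1)}`. -/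
def wedgeCoord (S : Set.powersetCard (Fin n) k) (f : Fin k → Fin n) : ℝ :=
  ((Pi.basisFun ℝ (Fin n)).exteriorPower k).repr
    (exteriorPower.ιMulti ℝ k (fun i => Pi.basisFun ℝ (Fin n) (f i))) S

theorem wedgeCoord_of_not_injective (S : Set.powersetCard (Fin n) k) {f : Fin k → Fin n}
    (hf : ¬Function.Injective f) : wedgeCoord S f = 0 := by
  rw [wedgeCoord, AlternatingMap.map_eq_zero_of_not_injective, map_zero, Finsupp.zero_apply]
  exact fun h => hf fun a b hab => h (by simp only [hab])

/-- Sorting distinct indices costs only a permutation sign, so the wedge is plus or minus one basis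
vector. -/
theorem wedgeCoord_of_injective {f : Fin k → Fin n} (hf : Function.Injective f) :
    ∃ T : Set.powersetCard (Fin n) k, (T : Finset (Fin n)) = Finset.univ.image f ∧
      (∀ S, S ≠ T → wedgeCoord S f = 0) ∧ |wedgeCoord T f| = 1 := by
  obtain ⟨T, hT⟩ : ∃ T : Set.powersetCard (Fin n) k,
      (T : Finset (Fin n)) = Finset.univ.image f :=
    ⟨⟨Finset.univ.image f, by
      rw [Set.powersetCard.mem_iff, Finset.card_image_of_injective _ hf, Finset.card_fin]⟩, rfl⟩
  have hmem : ∀ i, ∃ j, Set.powersetCard.ofFinEmbEquiv.symm T j = f i := by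
    intro i
    refine (Set.powersetCard.mem_range_ofFinEmbEquiv_symm_iff_mem T (f i)).mpr ?_
    rw [← Set.powersetCard.mem_coe_iff, hT]
    exact Finset.mem_image_of_mem f (Finset.mem_univ i)
  choose s hs using hmem
  have hsinj : Function.Injective s := fun a b hab => hf (by rw [← hs, ← hs, hab])
  let σ : Equiv.Perm (Fin k) := Equiv.ofBijective s (Finite.injective_iff_bijective.mp hsinj)
  have hwedge : exteriorPower.ιMulti ℝ k (fun i => Pi.basisFun ℝ (Fin n) (f i)) =
      Equiv.Perm.sign σ • exteriorPower.ιMulti_family ℝ k (Pi.basisFun ℝ (Fin n)) T := by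
    rw [exteriorPower.ιMulti_family, ← AlternatingMap.map_perm]
    congr 1
    funext i
    exact congrArg _ (hs i).symm
  refine ⟨T, hT, fun S hS => ?_, ?_⟩
  · rw [wedgeCoord, hwedge]
    rcases Int.units_eq_one_or (Equiv.Perm.sign σ) with h | h <;>
      simp [h, exteriorPower.basis_repr_ne ℝ k _ hS.symm]
  · rw [wedgeCoord, hwedge]
    rcases Int.units_eq_one_or (Equiv.Perm.sign σ) with h | h <;> simp [h]

theorem wedgeCoord_self (T : Set.powersetCard (Fin n) k) :
    wedgeCoord T (Set.powersetCard.ofFinEmbEquiv.symm T) = 1 :=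
  exteriorPower.basis_repr_self ℝ k _ T

theorem wedgeCoord_of_ne {S T : Set.powersetCard (Fin n) k} (h : S ≠ T) :
    wedgeCoord S (Set.powersetCard.ofFinEmbEquiv.symm T) = 0 :=
  exteriorPower.basis_repr_ne ℝ k _ h.symm

/-- The replacement either repeats an index or changes the index set. Hence only diagonal entries of
`M` reach the diagonal of the compound. -/
theorem wedgeCoord_update_of_ne (T : Set.powersetCard (Fin n) k) (i : Fin k) {l : Fin n}
    (hl : l ≠ Set.powersetCard.ofFinEmbEquiv.symm T i) :
    wedgeCoord T (Function.update (Set.powersetCard.ofFinEmbEquiv.symm T) i l) = 0 := by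
  by_cases hf : Function.Injective (Function.update (Set.powersetCard.ofFinEmbEquiv.symm T) i l)
  · obtain ⟨T', hT', hzero, -⟩ := wedgeCoord_of_injective hf
    refine hzero T ?_
    rintro rfl
    have hlT : l ∈ T := by
      rw [← Set.powersetCard.mem_coe_iff, hT']
      exact Finset.mem_image.mpr ⟨i, Finset.mem_univ _, Function.update_self ..⟩
    obtain ⟨j, hj⟩ := (Set.powersetCard.mem_range_ofFinEmbEquiv_symm_iff_mem T l).mpr hlT
    have hji : j ≠ i := by
      rintro rfl
      exact hl hj.symm
    exact hji (hf (by rw [Function.update_of_ne hji, Function.update_self, hj]))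
  · exact wedgeCoord_of_not_injective T hf

/-- At most one coordinate is nonzero, and the weights of sets are multiplicative. Strict inequality
arises only from repeated indices, where the left side is zero. -/
theorem sum_abs_wedgeCoord_le {u : Fin n → ℝ} (hu : ∀ i, 0 < u i) (f : Fin k → Fin n) :
    ∑ S : Set.powersetCard (Fin n) k, |wedgeCoord S f| * ∏ s ∈ (S : Finset (Fin n)), u s ≤
      ∏ i, u (f i) := by
  by_cases hf : Function.Injective f
  · obtain ⟨T, hT, hzero, hone⟩ := wedgeCoord_of_injective hf
    rw [Finset.sum_eq_single T (fun S _ hS => by rw [hzero S hS, abs_zero, zero_mul])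
      (fun h => absurd (Finset.mem_univ _) h), hone, one_mul, hT,
      Finset.prod_image fun a _ b _ hab => hf hab]
  · simp only [wedgeCoord_of_not_injective _ hf, abs_zero, zero_mul, Finset.sum_const_zero]
    exact Finset.prod_nonneg fun i _ => (hu _).le

theorem additiveCompound_apply (M : Matrix (Fin n) (Fin n) ℝ)
    (S T : Set.powersetCard (Fin n) k) :
    additiveCompound k M S T = ∑ i, ∑ l, M l (Set.powersetCard.ofFinEmbEquiv.symm T i) *
      wedgeCoord S (Function.update (Set.powersetCard.ofFinEmbEquiv.symm T) i l) := by
  set g := Set.powersetCard.ofFinEmbEquiv.symm T with hg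
  have hcol : ∀ a, Matrix.toLin' M (Pi.basisFun ℝ (Fin n) a) =
      ∑ l, M l a • Pi.basisFun ℝ (Fin n) l := by
    intro a
    ext b
    simp [Pi.single_apply]
  rw [additiveCompound, LinearMap.toMatrix_apply, exteriorPower.basis_apply,
    exteriorPower.ιMulti_family, additiveCompoundMap_apply_ιMulti, map_sum, Finsupp.finsetSum_apply]
  refine Finset.sum_congr rfl fun i _ => ?_
  rw [← hg, Function.comp_apply, hcol, AlternatingMap.map_update_sum, map_sum,
    Finsupp.finsetSum_apply]
  refine Finset.sum_congr rfl fun l _ => ?_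
  rw [AlternatingMap.map_update_smul, map_smul, Finsupp.smul_apply, smul_eq_mul, wedgeCoord]
  congr 4
  funext j
  by_cases h : j = i
  · subst h; simp
  · simp [h]

theorem additiveCompound_apply_self (M : Matrix (Fin n) (Fin n) ℝ)
    (T : Set.powersetCard (Fin n) k) :
    additiveCompound k M T T = ∑ i, M (Set.powersetCard.ofFinEmbEquiv.symm T i)
      (Set.powersetCard.ofFinEmbEquiv.symm T i) := by
  rw [additiveCompound_apply]
  refine Finset.sum_congr rfl fun i _ => ?_
  rw [Finset.sum_eq_single (Set.powersetCard.ofFinEmbEquiv.symm T i)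
    (fun l _ hl => by rw [wedgeCoord_update_of_ne T i hl, mul_zero])
    (fun h => absurd (Finset.mem_univ _) h), Function.update_eq_self, wedgeCoord_self, mul_one]

theorem abs_additiveCompound_apply_le (M : Matrix (Fin n) (Fin n) ℝ)
    {S T : Set.powersetCard (Fin n) k} (h : S ≠ T) :
    |additiveCompound k M S T| ≤
      ∑ i, ∑ l ∈ Finset.univ.erase (Set.powersetCard.ofFinEmbEquiv.symm T i),
        |M l (Set.powersetCard.ofFinEmbEquiv.symm T i)| *
          |wedgeCoord S (Function.update (Set.powersetCard.ofFinEmbEquiv.symm T) i l)| := by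
  rw [additiveCompound_apply]
  refine (Finset.abs_sum_le_sum_abs _ _).trans (Finset.sum_le_sum fun i _ => ?_)
  -- The term in which no index changes is a multiple of `e_T` and has no coordinate at `S`.
  rw [← Finset.add_sum_erase _ _ (Finset.mem_univ (Set.powersetCard.ofFinEmbEquiv.symm T i)),
    Function.update_eq_self, wedgeCoord_of_ne h, mul_zero, zero_add]
  simp only [← abs_mul]
  exact Finset.abs_sum_le_sum_abs _ _

/-- An off-diagonal contribution to column `T` replaces one index `g i` by some `l`, with
coefficient `M l (g i)`, and changes the weight factor `u (g i)` to `u l`. Dominance in column `g i`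
of `M`, multiplied by the weights of the other indices and summed over `i`, gives the bound. -/
theorem ColDominant.additiveCompound {u : Fin n → ℝ} (hu : ∀ i, 0 < u i)
    {M : Matrix (Fin n) (Fin n) ℝ} (h : ColDominant u M) (k : ℕ) :
    ColDominant (fun S : Set.powersetCard (Fin n) k => ∏ s ∈ (S : Finset (Fin n)), u s)
      (additiveCompound k M) := by
  intro T
  set g := Set.powersetCard.ofFinEmbEquiv.symm T with hg
  have hw : ∀ S : Set.powersetCard (Fin n) k, 0 ≤ ∏ s ∈ (S : Finset (Fin n)), u s :=
    fun S => Finset.prod_nonneg fun i _ => (hu i).le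
  have hT : ∏ s ∈ (T : Finset (Fin n)), u s = ∏ i, u (g i) := by
    have himg : (T : Finset (Fin n)) = Finset.univ.image g := by
      ext a
      rw [Set.powersetCard.mem_coe_iff,
        ← Set.powersetCard.mem_range_ofFinEmbEquiv_symm_iff_mem]
      simp [hg]
    rw [himg, Finset.prod_image fun a _ b _ hab => g.injective hab]
  calc ∑ S ∈ Finset.univ.erase T,
        |_root_.additiveCompound k M S T| * ∏ s ∈ (S : Finset (Fin n)), u s
      ≤ ∑ S ∈ Finset.univ.erase T, ∑ i, ∑ l ∈ Finset.univ.erase (g i), |M l (g i)| *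
          (|wedgeCoord S (Function.update g i l)| * ∏ s ∈ (S : Finset (Fin n)), u s) := by
        refine Finset.sum_le_sum fun S hS => ?_
        refine (mul_le_mul_of_nonneg_right
          (abs_additiveCompound_apply_le M (Finset.ne_of_mem_erase hS)) (hw S)).trans_eq ?_
        simp only [Finset.sum_mul, mul_assoc, ← hg]
    _ ≤ ∑ S, ∑ i, ∑ l ∈ Finset.univ.erase (g i), |M l (g i)| *
          (|wedgeCoord S (Function.update g i l)| * ∏ s ∈ (S : Finset (Fin n)), u s) :=
        Finset.sum_le_sum_of_subset_of_nonneg (Finset.subset_univ _) fun S _ _ =>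
          Finset.sum_nonneg fun i _ => Finset.sum_nonneg fun l _ =>
            mul_nonneg (abs_nonneg _) (mul_nonneg (abs_nonneg _) (hw S))
    _ = ∑ i, ∑ l ∈ Finset.univ.erase (g i), |M l (g i)| *
          ∑ S : Set.powersetCard (Fin n) k,
            |wedgeCoord S (Function.update g i l)| * ∏ s ∈ (S : Finset (Fin n)), u s := by
        rw [Finset.sum_comm]
        refine Finset.sum_congr rfl fun i _ => ?_
        rw [Finset.sum_comm]
        simp only [Finset.mul_sum]
    _ ≤ ∑ i, ∑ l ∈ Finset.univ.erase (g i), |M l (g i)| *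
          (u l * ∏ i' ∈ Finset.univ.erase i, u (g i')) := by
        refine Finset.sum_le_sum fun i _ => Finset.sum_le_sum fun l _ =>
          mul_le_mul_of_nonneg_left ((sum_abs_wedgeCoord_le hu _).trans_eq ?_) (abs_nonneg _)
        rw [← Finset.mul_prod_erase _ _ (Finset.mem_univ i), Function.update_self]
        refine congrArg _ (Finset.prod_congr rfl fun j hj => ?_)
        rw [Function.update_of_ne (Finset.ne_of_mem_erase hj)]
    _ ≤ ∑ i, M (g i) (g i) * u (g i) * ∏ i' ∈ Finset.univ.erase i, u (g i') := by
        refine Finset.sum_le_sum fun i _ => ?_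
        simp only [← mul_assoc, ← Finset.sum_mul]
        exact mul_le_mul_of_nonneg_right (h (g i)) (Finset.prod_nonneg fun j _ => (hu _).le)
    _ = _root_.additiveCompound k M T T * ∏ s ∈ (T : Finset (Fin n)), u s := by
        rw [additiveCompound_apply_self, hT, Finset.sum_mul]
        refine Finset.sum_congr rfl fun i _ => ?_
        rw [mul_assoc, Finset.mul_prod_erase _ (fun i => u (g i)) (Finset.mem_univ i)]

end Compound

/-! ### Products with sparse columns -/

/-- Both conditions hold on the qualitative class and are closed in `X`; the premise `A i j = 0`
does not involve `X`. -/
theorem mem_qualClassClosure_transpose {n m : ℕ} {A : Matrix (Fin n) (Fin m) ℝ}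
    {B : Matrix (Fin m) (Fin n) ℝ} (hB : B ∈ qualClassClosure Aᵀ) (i : Fin n) (j : Fin m) :
    0 ≤ A i j * B j i ∧ (A i j = 0 → B j i = 0) := by
  have hcont : Continuous fun X : Matrix (Fin m) (Fin n) ℝ => X j i :=
    continuous_id.matrix_elem j i
  have hclosed : IsClosed {X : Matrix (Fin m) (Fin n) ℝ |
      0 ≤ A i j * X j i ∧ (A i j = 0 → X j i = 0)} := by
    refine (isClosed_le continuous_const (continuous_const.mul hcont)).inter ?_
    exact isClosed_imp isOpen_const (isClosed_eq hcont continuous_const)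
  refine closure_minimal (fun X hX => ?_) hclosed hB
  obtain ⟨hpos, hneg, hzero⟩ := hX j i
  simp only [Matrix.transpose_apply] at hpos hneg hzero
  refine ⟨?_, hzero⟩
  rcases lt_trichotomy (A i j) 0 with h | h | h
  · exact (mul_pos_of_neg_of_neg h (hneg h)).le
  · rw [h, zero_mul]
  · exact (mul_pos h (hpos h)).le

/-- In the scaled column `j` of `A`, an entry in row `i` equal to `y j` faces at most one other, of
the same size. Columns with `A i j = 0` drop out because then `B j i = 0`, and the sign condition
identifies the diagonal entry with `∑ j, |A i j| * |B j i|`. -/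
theorem colDominant_mul {n m : ℕ} {A : Matrix (Fin n) (Fin m) ℝ} {B : Matrix (Fin m) (Fin n) ℝ}
    {x : Fin n → ℝ} {y : Fin m → ℝ} (hx : ∀ i, 0 < x i) (hy : ∀ j, 0 < y j)
    (hxy : ∀ i j, A i j ≠ 0 → |A i j| = x i * y j)
    (hB : ∀ i j, 0 ≤ A i j * B j i ∧ (A i j = 0 → B j i = 0))
    (hcol : ∀ j, (Finset.univ.filter (fun i => A i j ≠ 0)).card ≤ 2) :
    ColDominant (fun i => (x i)⁻¹) (A * B) := by
  intro i
  have hentry : ∀ k j, |A k j| * (x k)⁻¹ = if A k j ≠ 0 then y j else 0 := by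
    intro k j
    split_ifs with h
    · rw [hxy k j h]
      field_simp [(hx k).ne']
    · rw [not_not.mp h, abs_zero, zero_mul]
  have hle : ∀ j, A i j ≠ 0 →
      ∑ k ∈ Finset.univ.erase i, |A k j| * (x k)⁻¹ ≤ |A i j| * (x i)⁻¹ := by
    intro j hj
    simp only [hentry]
    rw [if_pos hj, ← Finset.sum_filter, Finset.sum_const, nsmul_eq_mul, Finset.filter_erase]
    have hcard := Finset.card_erase_of_mem
      (show i ∈ Finset.univ.filter (fun k => A k j ≠ 0) by simpa using hj)
    have h1 : ((Finset.univ.filter (fun k => A k j ≠ 0)).erase i).card ≤ 1 := by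
      have := hcol j
      omega
    exact mul_le_of_le_one_left (hy j).le (by exact_mod_cast h1)
  calc ∑ k ∈ Finset.univ.erase i, |(A * B) k i| * (x k)⁻¹
      ≤ ∑ k ∈ Finset.univ.erase i, ∑ j, |A k j| * (x k)⁻¹ * |B j i| := by
        refine Finset.sum_le_sum fun k _ => ?_
        rw [Matrix.mul_apply]
        refine (mul_le_mul_of_nonneg_right (Finset.abs_sum_le_sum_abs _ _)
          (inv_nonneg.mpr (hx k).le)).trans_eq ?_
        rw [Finset.sum_mul]
        refine Finset.sum_congr rfl fun j _ => ?_
        rw [abs_mul]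
        ring
    _ = ∑ j, (∑ k ∈ Finset.univ.erase i, |A k j| * (x k)⁻¹) * |B j i| := by
        rw [Finset.sum_comm]
        simp only [Finset.sum_mul]
    _ ≤ ∑ j, |A i j| * (x i)⁻¹ * |B j i| := by
        refine Finset.sum_le_sum fun j _ => ?_
        by_cases h : A i j = 0
        · rw [(hB i j).2 h, abs_zero, mul_zero, mul_zero]
        · exact mul_le_mul_of_nonneg_right (hle j h) (abs_nonneg _)
    _ = (A * B) i i * (x i)⁻¹ := by
        rw [Matrix.mul_apply, Finset.sum_mul]
        refine Finset.sum_congr rfl fun j _ => ?_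
        rw [mul_right_comm, ← abs_mul, abs_of_nonneg (hB i j).1]

/-- The characteristic polynomials of `A * B` and `B * A` agree up to powers of `X`, so the nonzero
eigenvalues coincide; the eigenvalue zero is harmless. -/
theorem isPositiveSemistable_mul_of_transpose {n m : ℕ} {A : Matrix (Fin n) (Fin m) ℝ}
    {B : Matrix (Fin m) (Fin n) ℝ} (h : IsPositiveSemistable (Aᵀ * Bᵀ)) :
    IsPositiveSemistable (A * B) := by
  intro z hz
  by_cases hz0 : z = 0
  · rw [hz0, Complex.zero_re]
  have hmap : ∀ {p q r : ℕ} (X : Matrix (Fin p) (Fin q) ℝ) (Y : Matrix (Fin q) (Fin r) ℝ),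
      (X * Y).map (fun x : ℝ => (x : ℂ)) =
        X.map (fun x : ℝ => (x : ℂ)) * Y.map (fun x : ℝ => (x : ℂ)) :=
    fun X Y => Matrix.map_mul (f := Complex.ofRealHom)
  refine h z ?_
  rw [Matrix.mem_spectrum_iff_isRoot_charpoly, hmap, Polynomial.IsRoot] at hz ⊢
  rw [Matrix.transpose_map, Matrix.transpose_map, ← Matrix.transpose_mul,
    Matrix.charpoly_transpose]
  have := congrArg (Polynomial.eval z) (Matrix.charpoly_mul_comm'
    (A.map (fun x : ℝ => (x : ℂ))) (B.map (fun x : ℝ => (x : ℂ))))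
  rw [Polynomial.eval_mul, Polynomial.eval_mul, hz, mul_zero, eq_comm, mul_eq_zero] at this
  refine this.resolve_left ?_
  rw [Polynomial.eval_pow, Polynomial.eval_X]
  exact pow_ne_zero _ hz0

end

theorem mainTheorem3 (n m : ℕ) (A : Matrix (Fin n) (Fin m) ℝ) (hA : DSRSteady A Aᵀ) :
    ((∀ j : Fin m, (Finset.univ.filter (fun i : Fin n => A i j ≠ 0)).card ≤ 2) →
      ∀ B ∈ qualClassClosure Aᵀ,
        IsP0Matrix (A * B) ∧ IsP0Matrix (additiveCompound 2 (A * B)) ∧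
          IsPositiveSemistable (A * B)) ∧
    ((∀ i : Fin n, (Finset.univ.filter (fun j : Fin m => A i j ≠ 0)).card ≤ 2) →
      ∀ B ∈ qualClassClosure Aᵀ, IsPositiveSemistable (A * B)) := by
  obtain ⟨x, y, hx, hy, hxy⟩ := hA.exists_rank_one
  refine ⟨fun hcol B hB => ?_, fun hrow B hB => ?_⟩
  · have hu : ∀ i, 0 < (x i)⁻¹ := fun i => inv_pos.mpr (hx i)
    have hdom := colDominant_mul hx hy hxy (mem_qualClassClosure_transpose hB) hcol
    exact ⟨hdom.isP0Matrix hu,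
      (hdom.additiveCompound hu 2).isP0Matrix fun S => Finset.prod_pos fun i _ => hu i,
      hdom.re_nonneg hu⟩
  -- The rows of `A` are the columns of `Aᵀ`, and the factorization transposes with `x` and `y`
  -- exchanged.
  · refine isPositiveSemistable_mul_of_transpose ?_
    refine (colDominant_mul (A := Aᵀ) (B := Bᵀ) hy hx (fun j i h => ?_) (fun j i => ?_)
      hrow).re_nonneg fun j => inv_pos.mpr (hy j)
    · rw [Matrix.transpose_apply, hxy i j h, mul_comm]
    · exact mem_qualClassClosure_transpose hB i j
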